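/- For integers $F, K \ge 1$ and $0 \le Z \le F$ and a finite set $S$, an $S$-PDA$(F,K,Z)$ (placement delivery array) is an $F \times K$ array $R = (r_{j,k})$ such that: (1) each cell is either empty or an element of $S$; (2) each column contains exactly $Z$ empty cells; (3) each row and each column contains every element of $S$ at most once; (4) if two different cells satisfy $r_{j_1,k_1} = r_{j_2,k_2} = t \in S$, then the cells $r_{j_1,k_2}$ and $r_{j_2,k_1}$ are empty. Let $s(F,K,Z) = \min\{\,|S| : \text{there is an } S\text{-PDA}(F,K,Z)\,\}$. Theorem. For every integer $F \ge 12$, $s(F,4,3) = 4F - 30$. -/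

import Mathlib

/-- An `F × K` array `R` with entries in `S` (`none` is the empty cell) is an
`S`-PDA`(F, K, Z)`, a placement delivery array. That each cell is either empty or an element
of `S` is expressed by the type of `R`. -/
structure IsPDA {S : Type*} (F K Z : ℕ) (R : Fin F → Fin K → Option S) : Prop where
  /-- Each column contains exactly `Z` empty cells. -/
  empty_cells : ∀ k, (Finset.univ.filter fun j => R j k = none).card = Z
  /-- Each row contains an element of `S` at most once. -/
  row_once : ∀ (t : S) (j : Fin F) (k₁ k₂ : Fin K),
    R j k₁ = some t → R j k₂ = some t → k₁ = k₂
  /-- Each column contains an element of `S` at most once. -/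
  col_once : ∀ (t : S) (j₁ j₂ : Fin F) (k : Fin K),
    R j₁ k = some t → R j₂ k = some t → j₁ = j₂
  /-- If two different cells contain the same element, the two opposite corners are empty. -/
  corners_empty : ∀ (t : S) (j₁ j₂ : Fin F) (k₁ k₂ : Fin K), (j₁, k₁) ≠ (j₂, k₂) →
    R j₁ k₁ = some t → R j₂ k₂ = some t → R j₁ k₂ = none ∧ R j₂ k₁ = none

/-- The set of all `|S|` for which there is an `S`-PDA`(F, K, Z)`; up to relabelling, `S` is
`Fin n`. -/
def pdaSizes (F K Z : ℕ) : Set ℕ :=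
  {n | ∃ R : Fin F → Fin K → Option (Fin n), IsPDA F K Z R}

/-- `s(F, K, Z)`, the minimum of `|S|` over all `S`-PDA`(F, K, Z)`. (For `Z ≤ F` such arrays
exist, so that the infimum is a minimum.) -/
noncomputable def pdaMin (F K Z : ℕ) : ℕ := sInf (pdaSizes F K Z)

/-! Lower bound by weighting: an element occurring `m` times lies only in rows with at least `m - 1`
empty cells, so its weight is at most `m * (3 - m) ≤ 2`. A row with `e` empty cells has weight at
least `8 - 5 * e`; double counting gives `8 * F - 20 * Z ≤ 2 * n`. Equality needs rows with at most
one empty cell, elements of a full row used once and all others twice. `twelveRowArray` achieves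
this, and each appended full row costs four new elements. -/

/-- An occurrence of an element in row `j` forces an empty cell in row `j` for every other
occurrence of that element. -/
theorem IsPDA.card_occurrences_le {S : Type*} [DecidableEq S] {F K Z : ℕ}
    {R : Fin F → Fin K → Option S} (h : IsPDA F K Z R) {t : S} {j : Fin F} {k : Fin K}
    (hjk : R j k = some t) :
    (Finset.univ.filter fun c : Fin F × Fin K => R c.1 c.2 = some t).card ≤
      (Finset.univ.filter fun k' => R j k' = none).card + 1 := by
  rw [← Finset.card_erase_add_one (a := (j, k)) (by simpa using hjk)]
  -- The other occurrences lie in distinct columns, each of which is empty in row `j`.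
  refine Nat.add_le_add_right (Finset.card_le_card_of_injOn Prod.snd ?_ ?_) 1
  · rintro ⟨j', k'⟩ hc
    simp only [Finset.coe_erase, Finset.coe_filter, Finset.mem_univ, true_and, Set.mem_sdiff,
      Set.mem_ofPred_eq, Set.mem_singleton_iff] at hc ⊢
    exact (h.corners_empty t j j' k k' (Ne.symm hc.2) hjk hc.1).1
  · rintro ⟨j₁, k₁⟩ h₁ ⟨j₂, k₂⟩ h₂ (rfl : k₁ = k₂)
    simp only [Finset.coe_erase, Finset.coe_filter, Finset.mem_univ, true_and, Set.mem_sdiff,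
      Set.mem_ofPred_eq, Set.mem_singleton_iff] at h₁ h₂
    rw [h.col_once t j₁ j₂ k₁ h₁.1 h₂.1]

/-- Weighting each nonempty cell by `2 - e`, with `e` the number of empty cells of its row, every
element has total weight at most `2`. -/
theorem IsPDA.sum_weight_le_two {S : Type*} [DecidableEq S] {F K Z : ℕ}
    {R : Fin F → Fin K → Option S} (h : IsPDA F K Z R) (t : S) :
    ∑ c : Fin F × Fin K with R c.1 c.2 = some t,
      (2 - (Finset.univ.filter fun k' => R c.1 k' = none).card) ≤ 2 := by
  set m := (Finset.univ.filter fun c : Fin F × Fin K => R c.1 c.2 = some t).card with hm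
  calc _ ≤ m * (3 - m) := by
        rw [hm, ← smul_eq_mul]
        refine Finset.sum_le_card_nsmul _ _ _ fun c hc => ?_
        have := h.card_occurrences_le (Finset.mem_filter.1 hc).2
        omega
    _ ≤ 2 := by
        rcases Nat.lt_or_ge m 3 with h3 | h3
        · interval_cases m <;> norm_num
        · simp [Nat.sub_eq_zero_of_le h3]

/-- The total number of empty cells, counted by rows. -/
theorem IsPDA.sum_card_empty_row {S : Type*} [DecidableEq S] {F K Z : ℕ}
    {R : Fin F → Fin K → Option S} (h : IsPDA F K Z R) :
    ∑ j, (Finset.univ.filter fun k => R j k = none).card = K * Z := by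
  simp only [Finset.card_filter]
  rw [Finset.sum_comm]
  simp only [← Finset.card_filter, h.empty_cells]
  simp

/-- The total weight of the nonempty cells, computed by rows and by elements. -/
theorem sum_weight_nonempty {S : Type*} [Fintype S] [DecidableEq S] {F K : ℕ}
    (R : Fin F → Fin K → Option S) (w : Fin F → ℕ) :
    ∑ t, ∑ c : Fin F × Fin K with R c.1 c.2 = some t, w c.1 =
      ∑ j, (K - (Finset.univ.filter fun k => R j k = none).card) * w j := by
  have hcell : ∀ (j : Fin F) (k : Fin K),
      ∑ t, (if R j k = some t then w j else 0) = if R j k = none then 0 else w j := by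
    intro j k
    cases R j k <;> simp
  simp only [Finset.sum_filter]
  rw [Finset.sum_comm, Fintype.sum_prod_type]
  refine Finset.sum_congr rfl fun j _ => ?_
  simp only [hcell]
  have hcard := Finset.card_filter_add_card_filter_not (s := (Finset.univ : Finset (Fin K)))
    (fun k => R j k = none)
  rw [Finset.card_univ, Fintype.card_fin] at hcard
  rw [← Nat.eq_sub_of_add_eq' hcard, Finset.card_filter, Finset.sum_mul]
  exact Finset.sum_congr rfl fun k _ => by split_ifs <;> simp_all

/-- The lower bound on the number of elements of a placement delivery array with four columns. -/
theorem IsPDA.four_mul_le {n F Z : ℕ} {R : Fin F → Fin 4 → Option (Fin n)}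
    (h : IsPDA F 4 Z R) : 4 * F ≤ n + 10 * Z := by
  have hupper : ∑ j, (4 - (Finset.univ.filter fun k => R j k = none).card) *
      (2 - (Finset.univ.filter fun k => R j k = none).card) ≤ 2 * n := by
    rw [← sum_weight_nonempty R fun j => 2 - (Finset.univ.filter fun k => R j k = none).card]
    refine (Finset.sum_le_sum fun t _ => h.sum_weight_le_two t).trans_eq ?_
    simp [mul_comm]
  -- Equality at `e = 0` and `e = 1`; for `e ≥ 2` the truncated product vanishes.
  have hrow : ∀ e : ℕ, 8 ≤ (4 - e) * (2 - e) + 5 * e := by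
    intro e
    rcases Nat.lt_or_ge e 2 with h2 | h2
    · interval_cases e <;> norm_num
    · omega
  have hlower : ∑ _j : Fin F, 8 ≤ _ := Finset.sum_le_sum fun j _ =>
    hrow (Finset.univ.filter fun k => R j k = none).card
  rw [Finset.sum_add_distrib, ← Finset.mul_sum, h.sum_card_empty_row] at hlower
  simp only [Finset.sum_const, Finset.card_univ, Fintype.card_fin, smul_eq_mul] at hlower
  omega

/-- A row of `K` new elements can be appended to a placement delivery array. -/
theorem add_mem_pdaSizes_succ {F K Z n : ℕ} (hn : n ∈ pdaSizes F K Z) :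
    n + K ∈ pdaSizes (F + 1) K Z := by
  obtain ⟨R, h⟩ := hn
  let R' : Fin (F + 1) → Fin K → Option (Fin (n + K)) :=
    Fin.snoc (α := fun _ => Fin K → Option (Fin (n + K)))
      (fun j k => (R j k).map (Fin.castAdd K)) (fun k => some (Fin.natAdd n k))
  have hcast : ∀ (j : Fin F) k, R' j.castSucc k = (R j k).map (Fin.castAdd K) := by
    intro j k; simp [R']
  have hlast : ∀ k, R' (Fin.last F) k = some (Fin.natAdd n k) := by
    intro k; simp [R']
  have hne : ∀ (t : Fin (n + K)) (j : Fin F) k k',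
      R' j.castSucc k = some t → R' (Fin.last F) k' ≠ some t := by
    intro t j k k' h₁ h₂
    rw [hcast, Option.map_eq_some_iff] at h₁
    obtain ⟨s, -, rfl⟩ := h₁
    rw [hlast, Option.some.injEq, Fin.ext_iff, Fin.val_natAdd, Fin.val_castAdd] at h₂
    omega
  have hold : ∀ (t : Fin (n + K)) (j : Fin F) k, R' j.castSucc k = some t →
      ∃ s, R j k = some s ∧ Fin.castAdd K s = t := by
    intro t j k h₁
    rwa [hcast, Option.map_eq_some_iff] at h₁
  have hnew : ∀ (t : Fin (n + K)) k₁ k₂, R' (Fin.last F) k₁ = some t →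
      R' (Fin.last F) k₂ = some t → k₁ = k₂ := by
    intro t k₁ k₂ h₁ h₂
    rw [← h₂, hlast, hlast, Option.some.injEq] at h₁
    exact Fin.natAdd_injective _ _ h₁
  refine ⟨R', ⟨fun k => ?_, fun t j k₁ k₂ h₁ h₂ => ?_, fun t j₁ j₂ k h₁ h₂ => ?_,
    fun t j₁ j₂ k₁ k₂ hc h₁ h₂ => ?_⟩⟩
  · rw [← h.empty_cells k, Finset.card_filter, Finset.card_filter, Fin.sum_univ_castSucc]
    simp [hcast, hlast]
  · induction j using Fin.lastCases with
    | last => exact hnew t k₁ k₂ h₁ h₂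
    | cast j =>
      obtain ⟨s, hs, rfl⟩ := hold _ _ _ h₁
      obtain ⟨s', hs', e⟩ := hold _ _ _ h₂
      obtain rfl := Fin.castAdd_injective _ _ e
      exact h.row_once _ j k₁ k₂ hs hs'
  · induction j₁ using Fin.lastCases with
    | last =>
      induction j₂ using Fin.lastCases with
      | last => rfl
      | cast j₂ => exact absurd h₁ (hne t j₂ k k h₂)
    | cast j₁ =>
      induction j₂ using Fin.lastCases with
      | last => exact absurd h₂ (hne t j₁ k k h₁)
      | cast j₂ =>
        obtain ⟨s, hs, rfl⟩ := hold _ _ _ h₁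
        obtain ⟨s', hs', e⟩ := hold _ _ _ h₂
        obtain rfl := Fin.castAdd_injective _ _ e
        rw [h.col_once _ j₁ j₂ k hs hs']
  · induction j₁ using Fin.lastCases with
    | last =>
      induction j₂ using Fin.lastCases with
      | last => exact absurd (by rw [hnew t k₁ k₂ h₁ h₂]) hc
      | cast j₂ => exact absurd h₁ (hne t j₂ _ _ h₂)
    | cast j₁ =>
      induction j₂ using Fin.lastCases with
      | last => exact absurd h₂ (hne t j₁ _ _ h₁)
      | cast j₂ =>
        obtain ⟨s, hs, rfl⟩ := hold _ _ _ h₁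
        obtain ⟨s', hs', e⟩ := hold _ _ _ h₂
        obtain rfl := Fin.castAdd_injective _ _ e
        have hc' : (j₁, k₁) ≠ (j₂, k₂) := by
          rintro ⟨⟩
          exact hc rfl
        rw [hcast, hcast, Option.map_eq_none_iff, Option.map_eq_none_iff]
        exact h.corners_empty _ j₁ j₂ k₁ k₂ hc' hs hs'

/-- The optimal array with twelve rows: row `j` has its only empty cell in column `j / 3`, and
cell `(j, k)` contains the element indexed by the pair `{j / 3, k}` and `j % 3`. -/
def twelveRowArray (j : Fin 12) (k : Fin 4) : Option (Fin 18) :=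
  let a := j.val / 3
  if a = k.val then none
  -- Numbers the pairs 01, 02, 03, 12, 13, 23 as 0 to 5.
  else some (Fin.ofNat 18 (3 * (a + k.val - if min a k.val = 0 then 1 else 0) + j.val % 3))

set_option maxRecDepth 20000 in
set_option maxHeartbeats 2000000 in
theorem isPDA_twelveRowArray : IsPDA 12 4 3 twelveRowArray where
  empty_cells := by decide
  row_once := by
    -- Comparing cells directly spares `decide` the quantifier over `t`.
    have H : ∀ (j : Fin 12) (k₁ k₂ : Fin 4), twelveRowArray j k₁ ≠ none →
        twelveRowArray j k₁ = twelveRowArray j k₂ → k₁ = k₂ := by decide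
    intro t j k₁ k₂ h₁ h₂
    exact H j k₁ k₂ (by simp [h₁]) (h₁.trans h₂.symm)
  col_once := by
    have H : ∀ (j₁ j₂ : Fin 12) (k : Fin 4), twelveRowArray j₁ k ≠ none →
        twelveRowArray j₁ k = twelveRowArray j₂ k → j₁ = j₂ := by decide
    intro t j₁ j₂ k h₁ h₂
    exact H j₁ j₂ k (by simp [h₁]) (h₁.trans h₂.symm)
  corners_empty := by
    have H : ∀ (j₁ j₂ : Fin 12) (k₁ k₂ : Fin 4), (j₁, k₁) ≠ (j₂, k₂) →
        twelveRowArray j₁ k₁ ≠ none → twelveRowArray j₁ k₁ = twelveRowArray j₂ k₂ →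
        twelveRowArray j₁ k₂ = none ∧ twelveRowArray j₂ k₁ = none := by
      decide
    intro t j₁ j₂ k₁ k₂ hc h₁ h₂
    exact H j₁ j₂ k₁ k₂ hc (by simp [h₁]) (h₁.trans h₂.symm)

theorem mem_pdaSizes_four_three (m : ℕ) : 18 + 4 * m ∈ pdaSizes (12 + m) 4 3 := by
  induction m with
  | zero => exact ⟨twelveRowArray, isPDA_twelveRowArray⟩
  | succ m ih => exact add_mem_pdaSizes_succ ih

theorem mainTheorem10 (F : ℕ) (hF : 12 ≤ F) :
    (pdaSizes F 4 3).Nonempty ∧ (pdaMin F 4 3 : ℤ) = 4 * (F : ℤ) - 30 := by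
  obtain ⟨m, rfl⟩ := Nat.exists_eq_add_of_le hF
  have hmem := mem_pdaSizes_four_three m
  refine ⟨⟨_, hmem⟩, ?_⟩
  have hle : pdaMin (12 + m) 4 3 ≤ 18 + 4 * m := Nat.sInf_le hmem
  obtain ⟨R, hR⟩ : pdaMin (12 + m) 4 3 ∈ pdaSizes (12 + m) 4 3 := Nat.sInf_mem ⟨_, hmem⟩
  have hge := hR.four_mul_le
  omega
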